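/- Let $f$ be a norm on $\mathbb{R}^d$ and let $x\in\mathbb{R}^d$ be nonzero. Write $\|\cdot\|$ for the Euclidean norm and $g$ for a standard normal vector in $\mathbb{R}^d$. Define the descent cone and the subdifferential $$\mathcal{D}(f,x)=\bigcup_{\tau>0}\{y\in\mathbb{R}^d: f(x+\tau y)\le f(x)\},\qquad \partial f(x)=\{u\in\mathbb{R}^d: f(y)\ge f(x)+\langle u,y-x\rangle\ \text{for all } y\in\mathbb{R}^d\},$$ the statistical dimension $\delta(C)=\mathbb{E}\big[\|\Pi_{\overline{C}}(g)\|^2\big]$ of a nonempty convex cone $C\subset\mathbb{R}^d$, where $\Pi_{\overline{C}}$ is the Euclidean projection onto the closure of $C$, and, for $\tau\ge 0$, $$F(\tau)=\mathbb{E}\big[\operatorname{dist}^2(g,\tau\cdot\partial f(x))\big],$$ where $\operatorname{dist}$ is the Euclidean distance and $\tau\cdot\partial f(x)=\{\tau s: s\in\partial f(x)\}$. Then $\partial f(x)$ is nonempty and bounded, the expectations defining $\delta(\mathcal{D}(f,x))$ and $F(\tau)$, $\tau\ge0$, are finite, and $$\Big|\delta\big(\mathcal{D}(f,x)\big)-\inf_{\tau\ge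 0}F(\tau)\Big|\le\frac{2\,\sup\{\|s\|: s\in\partial f(x)\}}{f(x/\|x\|)}.$$ -/

import Mathlib

namespace ConicGeometry

open MeasureTheory ProbabilityTheory
open scoped Pointwise

noncomputable section

/-- The descent cone of `f` at `x`: the union over `τ > 0` of `{y | f (x + τ y) ≤ f x}`. -/
def descentCone {d : ℕ} (f : EuclideanSpace ℝ (Fin d) → ℝ) (x : EuclideanSpace ℝ (Fin d)) :
    Set (EuclideanSpace ℝ (Fin d)) :=
  {y | ∃ τ : ℝ, 0 < τ ∧ f (x + τ • y) ≤ f x}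

/-- The subdifferential of `f` at `x`. -/
def subdifferential {d : ℕ} (f : EuclideanSpace ℝ (Fin d) → ℝ) (x : EuclideanSpace ℝ (Fin d)) :
    Set (EuclideanSpace ℝ (Fin d)) :=
  {u | ∀ y, f x + inner ℝ u (y - x) ≤ f y}

/-- The Euclidean projection `argmin {‖x - y‖² : y ∈ C}`. The minimizer exists and is unique when
`C` is nonempty, closed and convex (`existsUnique_argmin`); the value is irrelevant otherwise. -/
def proj {d : ℕ} (C : Set (EuclideanSpace ℝ (Fin d))) (x : EuclideanSpace ℝ (Fin d)) :
    EuclideanSpace ℝ (Fin d) :=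
  Classical.epsilon fun y => y ∈ C ∧ ∀ z ∈ C, ‖x - y‖ ^ 2 ≤ ‖x - z‖ ^ 2

theorem existsUnique_argmin {d : ℕ} {C : Set (EuclideanSpace ℝ (Fin d))}
    (hne : C.Nonempty) (hcl : IsClosed C) (hconv : Convex ℝ C) (x : EuclideanSpace ℝ (Fin d)) :
    ∃! y, y ∈ C ∧ ∀ z ∈ C, ‖x - y‖ ^ 2 ≤ ‖x - z‖ ^ 2 := by
  obtain ⟨y, hy, hmin⟩ := hcl.exists_infDist_eq_dist hne x
  have key : ∀ z ∈ C, ‖x - y‖ ≤ ‖x - z‖ := fun z hz => by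
    rw [← dist_eq_norm, ← dist_eq_norm, ← hmin]
    exact Metric.infDist_le_dist_of_mem hz
  refine ⟨y, ⟨hy, fun z hz => by have := key z hz; gcongr⟩, ?_⟩
  rintro w ⟨hw, hwmin⟩
  have hm : (1 / 2 : ℝ) • y + (1 / 2 : ℝ) • w ∈ C :=
    hconv hy hw (by norm_num) (by norm_num) (by norm_num)
  have h1 := key _ hm
  have h2 := hwmin y hy
  have h3 : ‖x - y‖ ^ 2 ≤ ‖x - ((1 / 2 : ℝ) • y + (1 / 2 : ℝ) • w)‖ ^ 2 := by gcongr
  have h4 := parallelogram_law_with_norm ℝ (x - y) (x - w)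
  have h5 : (x - y) + (x - w) = (2 : ℝ) • (x - ((1 / 2 : ℝ) • y + (1 / 2 : ℝ) • w)) := by
    module
  have h6 : (x - y) - (x - w) = w - y := by abel
  rw [h5, h6, norm_smul] at h4
  norm_num at h4
  have h7 : ‖w - y‖ ^ 2 ≤ 0 := by nlinarith
  have h8 : ‖w - y‖ = 0 := by nlinarith [norm_nonneg (w - y)]
  exact sub_eq_zero.mp (norm_eq_zero.mp h8)

theorem proj_spec {d : ℕ} {C : Set (EuclideanSpace ℝ (Fin d))}
    (hne : C.Nonempty) (hcl : IsClosed C) (hconv : Convex ℝ C) (x : EuclideanSpace ℝ (Fin d)) :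
    proj C x ∈ C ∧ ∀ z ∈ C, ‖x - proj C x‖ ^ 2 ≤ ‖x - z‖ ^ 2 :=
  Classical.epsilon_spec (existsUnique_argmin hne hcl hconv x).exists

/-- The statistical dimension of a convex cone `C`: the expected value of `‖Π g‖²`, where `Π` is
the Euclidean projection onto the closure of `C` and `g` is a standard normal vector. -/
def statDim {d : ℕ} (C : Set (EuclideanSpace ℝ (Fin d))) : ℝ :=
  ∫ g, ‖proj (closure C) g‖ ^ 2 ∂(stdGaussian (EuclideanSpace ℝ (Fin d)))

/-- The expected squared distance of a standard normal vector to the dilated set `τ S`. -/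
def expectedSqDist {d : ℕ} (S : Set (EuclideanSpace ℝ (Fin d))) (τ : ℝ) : ℝ :=
  ∫ g, Metric.infDist g (τ • S) ^ 2 ∂(stdGaussian (EuclideanSpace ℝ (Fin d)))

end

end ConicGeometry

open MeasureTheory ProbabilityTheory ConicGeometry
open scoped Pointwise

/-!
Write `S` for the subdifferential of `f` at `x` and `K` for the cone it generates. Since `f` is a
norm, `s ∈ S` means `⟪s, z⟫ ≤ f z` for all `z`, with equality at `z = x`. Hence every `v ∈ K` lies
in `t • S` for exactly one factor, `t = ⟪v, x⟫ / f x`. The closed descent cone is the polar of `K`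
(`closure_descentCone`), so by Moreau's decomposition (`proj_closure_descentCone`) the statistical
dimension is the mean of the squared distance from `g` to `K`, that is, of the minimum over `τ ≥ 0`
of `dist² (g, τ • S)`. The theorem compares the mean of this minimum with the minimum of the mean;
one inequality is immediate.

For the other one, let `τ` minimize the expected squared distance, let `T g = ⟪Π_K g, x⟫ / f x` be
the random minimizer, and let `H g` be the support function of `S` at the residual
`g - Π_{τ • S} g`, which is `-1/2` times the derivative of the squared distance at `τ`. Convexity
(`sq_norm_projResidual_sub_le`) gives
`dist² (g, K) ≥ dist² (g, τ • S) - 2 (T g - τ) H g`, and first-order optimality of `τ`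
(`mul_meanSupport_nonpos`) gives `(𝔼 T - τ) 𝔼 H ≤ 0`. After taking means, the loss is therefore at
most `2 Cov (T, H)`. Projections are nonexpansive, so `T` is `‖x‖ / f x`-Lipschitz and `H` is
`sup ‖s‖`-Lipschitz, and the Gaussian Poincaré inequality bounds the covariance by the product of
the Lipschitz constants (`LipschitzWith.abs_integral_mul_sub_le`).

The Poincaré inequality `Var h ≤ L²` for `L`-Lipschitz `h` is proved without Hermite expansions or
integration by parts. The Ornstein–Uhlenbeck operator `P_ρ` multiplies Lipschitz constants by `ρ`,
so `‖P_ρ h‖² ≤ C ρ²` for mean-zero `h`, with a constant `C` that depends on `L` and the dimension. The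
identity `⟪h, P_{ρ²} h⟫ = ‖P_ρ h‖²` and Cauchy–Schwarz, iterated along `ρ ^ 2 ^ k`, remove this
constant and yield the sharp contraction `⟪h, P_ρ h⟫ ≤ ρ ‖h‖²`
(`LipschitzWith.integral_mul_ornsteinUhlenbeck_le`). With `ρ = cos t`, and `X`, `Y` independent
standard normal vectors, this bounds `2 (1 - cos t) Var h` by the mean of
`|h (cos t • X + sin t • Y) - h X|²`. Dividing by `t²` and letting `t → 0`, the right-hand side
tends to the mean of `‖∇ h‖²` by Rademacher's theorem and dominated convergence.
-/

/-! ### Square-integrable functions -/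

theorem sq_integral_mul_le {Ω : Type*} [MeasurableSpace Ω] {μ : Measure Ω} {f g : Ω → ℝ}
    (hf : MemLp f 2 μ) (hg : MemLp g 2 μ) :
    (∫ x, f x * g x ∂μ) ^ 2 ≤ (∫ x, f x ^ 2 ∂μ) * ∫ x, g x ^ 2 ∂μ := by
  have hfg : Integrable (fun x => f x * g x) μ := hf.integrable_mul hg
  have h : ∀ t : ℝ, 0 ≤ (∫ x, f x ^ 2 ∂μ) * (t * t) + (2 * ∫ x, f x * g x ∂μ) * t +
      ∫ x, g x ^ 2 ∂μ := fun t => by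
    have h0 : 0 ≤ ∫ x, (t * f x + g x) ^ 2 ∂μ := integral_nonneg fun x => sq_nonneg _
    have h1 : ∀ x, (t * f x + g x) ^ 2 = (t * t) * f x ^ 2 + (2 * t) * (f x * g x) + g x ^ 2 :=
      fun x => by ring
    have h2 : Integrable (fun x => (t * t) * f x ^ 2) μ := hf.integrable_sq.const_mul _
    have h3 : Integrable (fun x => (2 * t) * (f x * g x)) μ := hfg.const_mul _
    have h4 : Integrable (fun x => (t * t) * f x ^ 2 + (2 * t) * (f x * g x)) μ := h2.add h3
    simp_rw [h1] at h0
    rw [integral_add h4 hg.integrable_sq, integral_add h2 h3, integral_const_mul,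
      integral_const_mul] at h0
    linarith
  have := discrim_le_zero h
  rw [discrim] at this
  linarith

theorem LipschitzWith.abs_sub_le {E : Type*} [NormedAddCommGroup E] {f : E → ℝ} {L : NNReal}
    (hf : LipschitzWith L f) (x y : E) : |f x - f y| ≤ L * ‖x - y‖ := by
  have := hf.dist_le_mul x y
  rwa [Real.dist_eq, dist_eq_norm] at this

/-! ### Rotation invariance and the Ornstein–Uhlenbeck operators -/

section Gaussian

variable {E : Type*} [NormedAddCommGroup E] [InnerProductSpace ℝ E] [FiniteDimensional ℝ E]
  [MeasurableSpace E] [BorelSpace E]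

theorem LipschitzWith.memLp_two_stdGaussian {f : E → ℝ} {L : NNReal} (hf : LipschitzWith L f) :
    MemLp f 2 (stdGaussian E) := by
  have hn : MemLp (fun x : E => ‖x‖) 2 (stdGaussian E) := IsGaussian.memLp_two_id.norm
  have h1 : MemLp (fun x : E => (L : ℝ) * ‖x‖) 2 (stdGaussian E) := hn.const_mul _
  have h2 : MemLp (fun _ : E => |f 0|) 2 (stdGaussian E) := memLp_const _
  have h3 : ∀ x, |f x| ≤ |f 0| + L * ‖x‖ := fun x => by
    have h4 := hf.abs_sub_le x 0
    rw [sub_zero] at h4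
    have h5 := abs_sub_abs_le_abs_sub (f x) (f 0)
    linarith
  refine (h2.add h1).of_le hf.continuous.aestronglyMeasurable (ae_of_all _ fun x => ?_)
  rw [Real.norm_eq_abs]
  exact (h3 x).trans (le_abs_self _)

theorem LipschitzWith.integrable_stdGaussian {f : E → ℝ} {L : NNReal} (hf : LipschitzWith L f) :
    Integrable f (stdGaussian E) :=
  hf.memLp_two_stdGaussian.integrable (by norm_num)

theorem measurePreserving_rotation {a b : ℝ} (h : a ^ 2 + b ^ 2 = 1) :
    MeasurePreserving (fun p : E × E => (a • p.1 + b • p.2, -b • p.1 + a • p.2))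
      ((stdGaussian E).prod (stdGaussian E)) ((stdGaussian E).prod (stdGaussian E)) := by
  have hn : ‖(⟨a, b⟩ : ℂ)‖ = 1 := by
    rw [Complex.norm_def, Complex.normSq_mk, ← sq, ← sq, h, Real.sqrt_one]
  obtain ⟨θ, hθ⟩ := (Complex.norm_eq_one_iff _).1 hn
  have ha : Real.cos θ = a := by
    have := congrArg Complex.re hθ
    rwa [Complex.exp_ofReal_mul_I_re] at this
  have hb : Real.sin θ = b := by
    have := congrArg Complex.im hθ
    rwa [Complex.exp_ofReal_mul_I_im] at this
  have := IsGaussian.map_rotation_eq_self (μ := stdGaussian E) (by simp) θ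
  refine ⟨by fun_prop, ?_⟩
  rw [← ha, ← hb]
  exact this

/-- Composing a rotation with the reflection of the second coordinate gives an involution, which is
what the self-adjointness of the Ornstein–Uhlenbeck operators needs. -/
theorem measurePreserving_reflection {a b : ℝ} (h : a ^ 2 + b ^ 2 = 1) :
    MeasurePreserving (fun p : E × E => (a • p.1 + b • p.2, b • p.1 - a • p.2))
      ((stdGaussian E).prod (stdGaussian E)) ((stdGaussian E).prod (stdGaussian E)) := by
  have hneg : MeasurePreserving (fun x : E => -x) (stdGaussian E) (stdGaussian E) :=
    ⟨by fun_prop, stdGaussian_map (LinearIsometryEquiv.neg ℝ (E := E))⟩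
  have := ((MeasurePreserving.id (stdGaussian E)).prod hneg).comp (measurePreserving_rotation h)
  convert this using 2 with p
  simp [Prod.map, sub_eq_neg_add]

theorem measurePreserving_combination {a b : ℝ} (h : a ^ 2 + b ^ 2 = 1) :
    MeasurePreserving (fun p : E × E => a • p.1 + b • p.2)
      ((stdGaussian E).prod (stdGaussian E)) (stdGaussian E) :=
  measurePreserving_fst.comp (measurePreserving_reflection h)

theorem LipschitzWith.integral_combination {f : E → ℝ} {L : NNReal} (hf : LipschitzWith L f)
    {a b : ℝ} (h : a ^ 2 + b ^ 2 = 1) :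
    ∫ p : E × E, f (a • p.1 + b • p.2) ∂(stdGaussian E).prod (stdGaussian E) =
      ∫ x, f x ∂stdGaussian E := by
  have := measurePreserving_combination (E := E) h
  nth_rw 3 [← this.map_eq]
  rw [integral_map this.measurable.aemeasurable hf.continuous.aestronglyMeasurable]

/-- The Ornstein–Uhlenbeck operator with correlation `ρ`, given by Mehler's formula. -/
noncomputable def ornsteinUhlenbeck (ρ : ℝ) (f : E → ℝ) (x : E) : ℝ :=
  ∫ y, f (ρ • x + √(1 - ρ ^ 2) • y) ∂stdGaussian E

theorem sq_add_sq_sqrt {ρ : ℝ} (h0 : 0 ≤ ρ) (h1 : ρ ≤ 1) : ρ ^ 2 + √(1 - ρ ^ 2) ^ 2 = 1 := by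
  rw [Real.sq_sqrt (by nlinarith)]
  ring

theorem LipschitzWith.integrable_affine {f : E → ℝ} {L : NNReal} (hf : LipschitzWith L f)
    (z : E) (b : ℝ) : Integrable (fun y => f (z + b • y)) (stdGaussian E) := by
  have h : LipschitzWith (L * ‖b‖₊) (fun y : E => f (z + b • y)) :=
    hf.comp (LipschitzWith.of_dist_le_mul fun x y => by
      rw [dist_add_left, dist_smul₀]; simp)
  exact h.integrable_stdGaussian

/-- The Ornstein–Uhlenbeck operators contract Lipschitz constants by the correlation. -/
theorem LipschitzWith.lipschitzWith_ornsteinUhlenbeck {f : E → ℝ} {L : NNReal} (hf : LipschitzWith L f)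
    {ρ : ℝ} (h0 : 0 ≤ ρ) : LipschitzWith (ρ.toNNReal * L) (ornsteinUhlenbeck ρ f) := by
  refine LipschitzWith.of_dist_le_mul fun x x' => ?_
  rw [Real.dist_eq, ornsteinUhlenbeck, ornsteinUhlenbeck,
    ← integral_sub (hf.integrable_affine _ _) (hf.integrable_affine _ _), ← Real.norm_eq_abs]
  refine (norm_integral_le_of_norm_le_const (C := ρ * L * dist x x')
    (ae_of_all _ fun y => ?_)).trans ?_
  · rw [Real.norm_eq_abs]
    refine (hf.abs_sub_le _ _).trans_eq ?_
    rw [add_sub_add_right_eq_sub, ← smul_sub, norm_smul, Real.norm_of_nonneg h0, dist_eq_norm]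
    ring
  · simp [h0]

theorem LipschitzWith.integral_ornsteinUhlenbeck {f : E → ℝ} {L : NNReal}
    (hf : LipschitzWith L f) {ρ : ℝ} (h0 : 0 ≤ ρ) (h1 : ρ ≤ 1) :
    ∫ x, ornsteinUhlenbeck ρ f x ∂stdGaussian E = ∫ x, f x ∂stdGaussian E := by
  rw [← hf.integral_combination (sq_add_sq_sqrt h0 h1)]
  exact (integral_prod (μ := stdGaussian E) (ν := stdGaussian E)
    (fun p : E × E => f (ρ • p.1 + √(1 - ρ ^ 2) • p.2))
    ((measurePreserving_combination (sq_add_sq_sqrt h0 h1)).integrable_comp_of_integrable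
      hf.integrable_stdGaussian)).symm

theorem LipschitzWith.memLp_combination {f : E → ℝ} {L : NNReal} (hf : LipschitzWith L f)
    {a b : ℝ} (h : a ^ 2 + b ^ 2 = 1) :
    MemLp (fun p : E × E => f (a • p.1 + b • p.2)) 2
      ((stdGaussian E).prod (stdGaussian E)) :=
  hf.memLp_two_stdGaussian.comp_measurePreserving (measurePreserving_combination h)

theorem LipschitzWith.memLp_fst {f : E → ℝ} {L : NNReal} (hf : LipschitzWith L f) :
    MemLp (fun p : E × E => f p.1) 2 ((stdGaussian E).prod (stdGaussian E)) :=
  hf.memLp_two_stdGaussian.comp_measurePreserving measurePreserving_fst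

theorem LipschitzWith.integral_mul_ornsteinUhlenbeck {f g : E → ℝ} {L M : NNReal}
    (hf : LipschitzWith L f) (hg : LipschitzWith M g) {ρ : ℝ} (h0 : 0 ≤ ρ) (h1 : ρ ≤ 1) :
    ∫ x, g x * ornsteinUhlenbeck ρ f x ∂stdGaussian E =
      ∫ p : E × E, g p.1 * f (ρ • p.1 + √(1 - ρ ^ 2) • p.2)
        ∂(stdGaussian E).prod (stdGaussian E) := by
  have hint : Integrable (fun p : E × E => g p.1 * f (ρ • p.1 + √(1 - ρ ^ 2) • p.2))
      ((stdGaussian E).prod (stdGaussian E)) :=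
    hg.memLp_fst.integrable_mul (hf.memLp_combination (sq_add_sq_sqrt h0 h1))
  rw [integral_prod _ hint]
  simp_rw [integral_const_mul]
  rfl

theorem LipschitzWith.integral_mul_ornsteinUhlenbeck_comm {f g : E → ℝ} {L M : NNReal}
    (hf : LipschitzWith L f) (hg : LipschitzWith M g) {ρ : ℝ} (h0 : 0 ≤ ρ) (h1 : ρ ≤ 1) :
    ∫ x, g x * ornsteinUhlenbeck ρ f x ∂stdGaussian E =
      ∫ x, f x * ornsteinUhlenbeck ρ g x ∂stdGaussian E := by
  rw [hf.integral_mul_ornsteinUhlenbeck hg h0 h1, hg.integral_mul_ornsteinUhlenbeck hf h0 h1]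
  have hs := sq_add_sq_sqrt h0 h1
  have hT := measurePreserving_reflection (E := E) hs
  have hc : Continuous fun p : E × E => g p.1 * f (ρ • p.1 + √(1 - ρ ^ 2) • p.2) :=
    (hg.continuous.comp (by fun_prop)).mul (hf.continuous.comp (by fun_prop))
  nth_rw 1 [← hT.map_eq]
  rw [integral_map hT.measurable.aemeasurable hc.aestronglyMeasurable]
  -- The reflection is an involution, so it exchanges the two correlated vectors.
  refine integral_congr_ae (ae_of_all _ fun p => ?_)
  dsimp only
  have : ρ • (ρ • p.1 + √(1 - ρ ^ 2) • p.2) + √(1 - ρ ^ 2) • (√(1 - ρ ^ 2) • p.1 - ρ • p.2) =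
      (ρ ^ 2 + √(1 - ρ ^ 2) ^ 2) • p.1 := by module
  rw [this, hs, one_smul, mul_comm]

theorem LipschitzWith.ornsteinUhlenbeck_ornsteinUhlenbeck {f : E → ℝ} {L : NNReal}
    (hf : LipschitzWith L f) {ρ : ℝ} (h0 : 0 ≤ ρ) (h1 : ρ < 1) (x : E) :
    ornsteinUhlenbeck ρ (ornsteinUhlenbeck ρ f) x =
      ornsteinUhlenbeck (ρ ^ 2) f x := by
  have hρ2 : ρ ^ 2 < 1 := by nlinarith
  have hpos : 0 < 1 - (ρ ^ 2) ^ 2 := by nlinarith [sq_nonneg ρ]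
  set s := √(1 - ρ ^ 2) with hs
  set s' := √(1 - (ρ ^ 2) ^ 2) with hs'
  have hs'0 : 0 < s' := Real.sqrt_pos.2 hpos
  have hss : s ^ 2 = 1 - ρ ^ 2 := Real.sq_sqrt (by linarith)
  have hss' : s' ^ 2 = 1 - (ρ ^ 2) ^ 2 := Real.sq_sqrt hpos.le
  -- Two successive noises `ρ s Y + s Z` merge into one noise of standard deviation `s'`.
  have hab : (ρ * s / s') ^ 2 + (s / s') ^ 2 = 1 := by
    rw [div_pow, div_pow, ← add_div, mul_pow, hss, hss', div_eq_one_iff_eq hpos.ne']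
    ring
  have hg : LipschitzWith (L * ‖s'‖₊) (fun y : E => f (ρ ^ 2 • x + s' • y)) :=
    hf.comp (LipschitzWith.of_dist_le_mul fun x y => by
      rw [dist_add_left, dist_smul₀]; simp)
  have hmain := hg.integral_combination hab
  have hint : Integrable
      (fun p : E × E => f (ρ ^ 2 • x + s' • ((ρ * s / s') • p.1 + (s / s') • p.2)))
      ((stdGaussian E).prod (stdGaussian E)) :=
    (measurePreserving_combination hab).integrable_comp_of_integrable hg.integrable_stdGaussian
  rw [integral_prod _ hint] at hmain
  rw [ornsteinUhlenbeck, ornsteinUhlenbeck, ← hs', ← hmain]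
  simp only [ornsteinUhlenbeck, ← hs]
  congr! 5 with y z
  rw [smul_add s', smul_smul s', smul_smul s', mul_div_cancel₀ _ hs'0.ne',
    mul_div_cancel₀ _ hs'0.ne']
  module

/-- Self-adjointness and the semigroup law combined: `‖P_ρ f‖² = ⟪f, P_{ρ²} f⟫`. -/
theorem LipschitzWith.integral_sq_ornsteinUhlenbeck {f : E → ℝ} {L : NNReal}
    (hf : LipschitzWith L f) {ρ : ℝ} (h0 : 0 ≤ ρ) (h1 : ρ < 1) :
    ∫ x, ornsteinUhlenbeck ρ f x ^ 2 ∂stdGaussian E =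
      ∫ x, f x * ornsteinUhlenbeck (ρ ^ 2) f x ∂stdGaussian E := by
  simp_rw [sq (ornsteinUhlenbeck ρ f _)]
  rw [hf.integral_mul_ornsteinUhlenbeck_comm (hf.lipschitzWith_ornsteinUhlenbeck h0) h0 h1.le]
  simp_rw [hf.ornsteinUhlenbeck_ornsteinUhlenbeck h0 h1]

/-- A variance bound with a constant depending on the dimension. -/
theorem exists_integral_sq_le_of_lipschitzWith (E : Type*) [NormedAddCommGroup E]
    [InnerProductSpace ℝ E] [FiniteDimensional ℝ E] [MeasurableSpace E] [BorelSpace E] :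
    ∃ K : ℝ, ∀ (f : E → ℝ) (L : NNReal), LipschitzWith L f → ∫ x, f x ∂stdGaussian E = 0 →
      ∫ x, f x ^ 2 ∂stdGaussian E ≤ (L : ℝ) ^ 2 * K := by
  have hn : MemLp (fun x : E => ‖x‖) 2 (stdGaussian E) :=
    (IsGaussian.memLp_two_id (μ := stdGaussian E)).norm
  have hn1 : Integrable (fun x : E => ‖x‖) (stdGaussian E) := hn.integrable (by norm_num)
  refine ⟨∫ x : E, (‖x‖ + ∫ y : E, ‖y‖ ∂stdGaussian E) ^ 2 ∂stdGaussian E,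
    fun f L hf h0 => ?_⟩
  rw [← integral_const_mul]
  refine integral_mono hf.memLp_two_stdGaussian.integrable_sq
    ((hn.add (memLp_const _)).integrable_sq.const_mul _) fun x => ?_
  dsimp only
  rw [← mul_pow, ← sq_abs]
  refine pow_le_pow_left₀ (abs_nonneg _) ?_ 2
  have h1 : f x = ∫ y, (f x - f y) ∂stdGaussian E := by
    rw [integral_sub (integrable_const _) hf.integrable_stdGaussian, h0]
    simp
  calc |f x| = ‖∫ y, (f x - f y) ∂stdGaussian E‖ := by rw [← h1, Real.norm_eq_abs]
    _ ≤ ∫ y, (L : ℝ) * (‖x‖ + ‖y‖) ∂stdGaussian E :=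
        norm_integral_le_of_norm_le (((integrable_const _).add hn1).const_mul _)
          (ae_of_all _ fun y => (hf.abs_sub_le x y).trans
            (mul_le_mul_of_nonneg_left (norm_sub_le x y) L.2))
    _ = _ := by
        rw [integral_const_mul, integral_add (integrable_const _) hn1]
        simp

/-- The Ornstein–Uhlenbeck operator with correlation `ρ` contracts mean-zero functions by `ρ`.
The ratio `⟪f, P_σ f⟫ / ‖f‖²` is at least squared when `σ` is replaced by `σ²`, by Cauchy–Schwarz,
while the dimension-dependent variance bound makes it `O(σ)` along `σ = ρ ^ 2 ^ k`; so the ratio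
at `ρ` cannot exceed `ρ`. -/
theorem LipschitzWith.integral_mul_ornsteinUhlenbeck_le {f : E → ℝ} {L : NNReal}
    (hf : LipschitzWith L f) (hmean : ∫ x, f x ∂stdGaussian E = 0) {ρ : ℝ} (h0 : 0 < ρ)
    (h1 : ρ < 1) :
    ∫ x, f x * ornsteinUhlenbeck ρ f x ∂stdGaussian E ≤
      ρ * ∫ x, f x ^ 2 ∂stdGaussian E := by
  obtain ⟨K, hK⟩ := exists_integral_sq_le_of_lipschitzWith E
  set V := ∫ x, f x ^ 2 ∂stdGaussian E with hV
  set c : ℝ → ℝ := fun σ => ∫ x, f x * ornsteinUhlenbeck σ f x ∂stdGaussian E with hc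
  have hV0 : 0 ≤ V := integral_nonneg fun x => sq_nonneg _
  have hcs : ∀ σ, 0 ≤ σ → σ < 1 → c σ ^ 2 ≤ V * c (σ ^ 2) := fun σ hσ0 hσ1 => by
    rw [hc]
    dsimp only
    rw [← hf.integral_sq_ornsteinUhlenbeck hσ0 hσ1]
    exact sq_integral_mul_le hf.memLp_two_stdGaussian
      (hf.lipschitzWith_ornsteinUhlenbeck hσ0).memLp_two_stdGaussian
  have hcb : ∀ σ, 0 ≤ σ → σ < 1 → c (σ ^ 2) ≤ σ ^ 2 * (L ^ 2 * K) := fun σ hσ0 hσ1 => by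
    rw [hc]
    dsimp only
    rw [← hf.integral_sq_ornsteinUhlenbeck hσ0 hσ1]
    refine (hK _ _ (hf.lipschitzWith_ornsteinUhlenbeck hσ0)
      (by rw [hf.integral_ornsteinUhlenbeck hσ0 hσ1.le, hmean])).trans_eq ?_
    rw [NNReal.coe_mul, Real.coe_toNNReal _ hσ0]
    ring
  by_contra! hlt
  change ρ * V < c ρ at hlt
  rcases hV0.eq_or_lt with hV' | hV'
  · have := hcs ρ h0.le h1
    rw [← hV'] at this hlt
    nlinarith
  have hr : 1 < c ρ / (ρ * V) := (one_lt_div (by positivity)).2 hlt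
  have hpow1 : ∀ k : ℕ, ρ ^ 2 ^ k < 1 := fun k =>
    pow_lt_one₀ h0.le h1 (by positivity)
  have hind : ∀ k : ℕ, (c ρ / V) ^ 2 ^ k ≤ c (ρ ^ 2 ^ k) / V := by
    intro k
    induction k with
    | zero => simp
    | succ k ih =>
      have hc0 : 0 ≤ (c ρ / V) ^ 2 ^ k := by
        have : 0 < c ρ := (by positivity : 0 ≤ ρ * V).trans_lt hlt
        positivity
      rw [pow_succ 2 k, pow_mul, pow_mul]
      calc ((c ρ / V) ^ 2 ^ k) ^ 2 ≤ (c (ρ ^ 2 ^ k) / V) ^ 2 := pow_le_pow_left₀ hc0 ih 2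
        _ = c (ρ ^ 2 ^ k) ^ 2 / V / V := by rw [div_pow, sq V, div_div]
        _ ≤ V * c ((ρ ^ 2 ^ k) ^ 2) / V / V := by
            gcongr
            exact hcs _ (by positivity) (hpow1 k)
        _ = _ := by rw [mul_div_cancel_left₀ _ hV'.ne']
  have hbound : ∀ k : ℕ, (c ρ / (ρ * V)) ^ 2 ^ (k + 1) ≤ L ^ 2 * K / V := by
    intro k
    have h2 := hind (k + 1)
    have h3 := hcb _ (by positivity) (hpow1 k)
    rw [← pow_mul, ← pow_succ] at h3
    have h4 : (c ρ / V) ^ 2 ^ (k + 1) ≤ ρ ^ 2 ^ (k + 1) * (L ^ 2 * K) / V :=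
      h2.trans (by gcongr)
    have h5 : c ρ / (ρ * V) = c ρ / V / ρ := by rw [div_div, mul_comm]
    rw [h5, div_pow, div_le_iff₀ (by positivity)]
    exact h4.trans_eq (by ring)
  obtain ⟨n, hn⟩ := pow_unbounded_of_one_lt (L ^ 2 * K / V) hr
  have h6 : n ≤ 2 ^ (n + 1) := (Nat.lt_two_pow_self.trans (Nat.pow_lt_pow_right (by norm_num)
    (Nat.lt_succ_self n))).le
  exact absurd (hbound n) (not_le.2 (hn.trans_le (pow_le_pow_right₀ hr.le h6)))

end Gaussian

/-! ### The Gaussian Poincaré inequality for Lipschitz functions -/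

theorem pi_absolutelyContinuous_fin {n : ℕ} {μ ν : Measure ℝ} [SigmaFinite μ] [SigmaFinite ν]
    (h : μ ≪ ν) : Measure.pi (fun _ : Fin n => μ) ≪ Measure.pi (fun _ : Fin n => ν) := by
  induction n with
  | zero =>
    rw [Measure.pi_of_empty _ isEmptyElim, Measure.pi_of_empty _ isEmptyElim]
  | succ n ih =>
    have h1 := (measurePreserving_piFinSuccAbove (fun _ : Fin (n + 1) => μ) 0).symm
    have h2 := (measurePreserving_piFinSuccAbove (fun _ : Fin (n + 1) => ν) 0).symm
    rw [← h1.map_eq, ← h2.map_eq]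
    exact (h.prod ih).map h1.measurable

section RotationQuotient

variable {E : Type*} [NormedAddCommGroup E] [InnerProductSpace ℝ E]

/-- Difference quotients along the rotation curve `t ↦ cos t • x + sin t • y` at `t = 1/(n+1)`. -/
noncomputable def rotationQuotient (f : E → ℝ) (n : ℕ) (p : E × E) : ℝ :=
  (1 / ((n : ℝ) + 1))⁻¹ *
    (f (Real.cos (1 / ((n : ℝ) + 1)) • p.1 + Real.sin (1 / ((n : ℝ) + 1)) • p.2) - f p.1)

theorem tendsto_rotationQuotient {f : E → ℝ} {x : E} (hf : DifferentiableAt ℝ f x) (y : E) :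
    Filter.Tendsto (fun n => rotationQuotient f n (x, y)) Filter.atTop
      (nhds (fderiv ℝ f x y)) := by
  have h1 : HasDerivAt (fun t : ℝ => Real.cos t • x + Real.sin t • y) y 0 := by
    have := ((Real.hasDerivAt_cos 0).smul_const x).add ((Real.hasDerivAt_sin 0).smul_const y)
    simpa [Pi.add_def] using this
  have h2 : HasDerivAt (f ∘ fun t : ℝ => Real.cos t • x + Real.sin t • y) (fderiv ℝ f x y) 0 := by
    refine HasFDerivAt.comp_hasDerivAt 0 ?_ h1
    simpa using hf.hasFDerivAt
  have h3 := h2.tendsto_slope_zero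
  have h4 : Filter.Tendsto (fun n : ℕ => 1 / ((n : ℝ) + 1)) Filter.atTop
      (nhdsWithin 0 {0}ᶜ) :=
    tendsto_nhdsWithin_iff.2 ⟨tendsto_one_div_add_atTop_nhds_zero_nat,
      Filter.Eventually.of_forall fun n => by
        have : (0 : ℝ) < 1 / ((n : ℝ) + 1) := by positivity
        exact this.ne'⟩
  have h5 := h3.comp h4
  simpa [Function.comp_def, rotationQuotient] using h5

/-- A bound uniform in `n`, which serves as the dominating function for the limit `n → ∞`. -/
theorem LipschitzWith.abs_rotationQuotient_le {f : E → ℝ} {L : NNReal} (hf : LipschitzWith L f)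
    (n : ℕ) (p : E × E) : |rotationQuotient f n p| ≤ L * (‖p.1‖ + ‖p.2‖) := by
  rw [rotationQuotient]
  have ht : (0 : ℝ) < 1 / ((n : ℝ) + 1) := by positivity
  have ht1 : 1 / ((n : ℝ) + 1) ≤ 1 := by
    rw [div_le_one (by positivity)]
    linarith [(Nat.cast_nonneg n : (0 : ℝ) ≤ n)]
  set t := 1 / ((n : ℝ) + 1)
  have hcos : |Real.cos t - 1| ≤ t := by
    rw [abs_sub_comm, abs_of_nonneg (by linarith [Real.cos_le_one t])]
    nlinarith [Real.one_sub_sq_div_two_le_cos (x := t)]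
  have hsin : |Real.sin t| ≤ t := by
    rw [← abs_of_pos ht]
    exact Real.abs_sin_le_abs.trans (le_of_eq (by rw [abs_abs]))
  have hnorm : ‖Real.cos t • p.1 + Real.sin t • p.2 - p.1‖ ≤ t * (‖p.1‖ + ‖p.2‖) := by
    have : Real.cos t • p.1 + Real.sin t • p.2 - p.1 =
        (Real.cos t - 1) • p.1 + Real.sin t • p.2 := by module
    rw [this, mul_add]
    refine (norm_add_le _ _).trans ?_
    rw [norm_smul, norm_smul, Real.norm_eq_abs, Real.norm_eq_abs]
    gcongr
  rw [abs_mul, abs_inv, abs_of_pos ht, inv_mul_le_iff₀ ht]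
  refine (hf.abs_sub_le _ _).trans ((mul_le_mul_of_nonneg_left hnorm L.coe_nonneg).trans_eq ?_)
  ring

end RotationQuotient

section Gaussian

variable {E : Type*} [NormedAddCommGroup E] [InnerProductSpace ℝ E] [FiniteDimensional ℝ E]
  [MeasurableSpace E] [BorelSpace E]

theorem stdGaussian_absolutelyContinuous : stdGaussian E ≪ (volume : Measure E) := by
  have h1 := ((stdOrthonormalBasis ℝ E).measurePreserving_repr_symm.comp
    (PiLp.volume_preserving_toLp (Fin (Module.finrank ℝ E))))
  have h2 : (fun x : Fin (Module.finrank ℝ E) → ℝ => ∑ i, x i • stdOrthonormalBasis ℝ E i) =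
      (stdOrthonormalBasis ℝ E).repr.symm ∘ WithLp.toLp 2 := by
    funext x
    simp [OrthonormalBasis.sum_repr_symm]
  rw [stdGaussian, h2, ← h1.map_eq]
  exact (pi_absolutelyContinuous_fin (gaussianReal_absolutelyContinuous 0 one_ne_zero)).map
    h1.measurable

theorem integral_sq_strongDual_stdGaussian (ℓ : StrongDual ℝ E) :
    ∫ y, ℓ y ^ 2 ∂stdGaussian E = ‖ℓ‖ ^ 2 := by
  rw [← variance_dual_stdGaussian, variance_of_integral_eq_zero ℓ.continuous.aemeasurable
    (integral_strongDual_stdGaussian ℓ)]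

/-- The spectral gap estimate, written with difference quotients. -/
theorem LipschitzWith.mul_integral_sq_le_integral_sq_rotationQuotient {f : E → ℝ} {L : NNReal}
    (hf : LipschitzWith L f) (hmean : ∫ x, f x ∂stdGaussian E = 0) (n : ℕ) :
    2 * (1 - Real.cos (1 / ((n : ℝ) + 1))) / (1 / ((n : ℝ) + 1)) ^ 2 *
        ∫ x, f x ^ 2 ∂stdGaussian E ≤
      ∫ p, rotationQuotient f n p ^ 2 ∂(stdGaussian E).prod (stdGaussian E) := by
  simp only [rotationQuotient]
  have ht : (0 : ℝ) < 1 / ((n : ℝ) + 1) := by positivity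
  have ht1 : 1 / ((n : ℝ) + 1) ≤ 1 := by
    rw [div_le_one (by positivity)]
    linarith [(Nat.cast_nonneg n : (0 : ℝ) ≤ n)]
  set t := 1 / ((n : ℝ) + 1)
  have hsin : 0 < Real.sin t := Real.sin_pos_of_pos_of_le_one ht ht1
  have hcos0 : 0 < Real.cos t := Real.cos_pos_of_le_one (by rw [abs_of_pos ht]; exact ht1)
  have hcos1 : Real.cos t < 1 := by
    nlinarith [Real.sin_sq_add_cos_sq t, Real.cos_le_one t]
  have hsqrt : √(1 - Real.cos t ^ 2) = Real.sin t := by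
    rw [← Real.abs_sin_eq_sqrt_one_sub_cos_sq, abs_of_pos hsin]
  have hgap := hf.integral_mul_ornsteinUhlenbeck_le hmean hcos0 hcos1
  rw [hf.integral_mul_ornsteinUhlenbeck hf hcos0.le hcos1.le, hsqrt] at hgap
  have hcs : Real.cos t ^ 2 + Real.sin t ^ 2 = 1 := Real.cos_sq_add_sin_sq t
  have hA := hf.memLp_combination hcs
  have hB := hf.memLp_fst
  have hAB : Integrable (fun p : E × E => f p.1 * f (Real.cos t • p.1 + Real.sin t • p.2))
    ((stdGaussian E).prod (stdGaussian E)) := hB.integrable_mul hA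
  have hA2 : ∫ p : E × E, f (Real.cos t • p.1 + Real.sin t • p.2) ^ 2
      ∂(stdGaussian E).prod (stdGaussian E) = ∫ x, f x ^ 2 ∂stdGaussian E := by
    have := measurePreserving_combination (E := E) hcs
    have hfc := hf.continuous
    nth_rw 3 [← this.map_eq]
    rw [integral_map this.measurable.aemeasurable
      (by fun_prop : Continuous fun x => f x ^ 2).aestronglyMeasurable]
  have hB2 : ∫ p : E × E, f p.1 ^ 2 ∂(stdGaussian E).prod (stdGaussian E) =
      ∫ x, f x ^ 2 ∂stdGaussian E := by
    simpa using integral_fun_fst (μ := stdGaussian E) (ν := stdGaussian E) (fun x => f x ^ 2)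
  have hexp : ∀ p : E × E,
      (t⁻¹ * (f (Real.cos t • p.1 + Real.sin t • p.2) - f p.1)) ^ 2 =
        (t ^ 2)⁻¹ * (f (Real.cos t • p.1 + Real.sin t • p.2) ^ 2 + f p.1 ^ 2 -
          2 * (f p.1 * f (Real.cos t • p.1 + Real.sin t • p.2))) := fun p => by
    rw [mul_pow, inv_pow]
    ring
  simp_rw [hexp]
  have hi1 : Integrable (fun p : E × E => f (Real.cos t • p.1 + Real.sin t • p.2) ^ 2 + f p.1 ^ 2)
    ((stdGaussian E).prod (stdGaussian E)) := hA.integrable_sq.add hB.integrable_sq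
  rw [integral_const_mul, integral_sub hi1 (hAB.const_mul 2),
    integral_add hA.integrable_sq hB.integrable_sq, integral_const_mul, hA2, hB2,
    div_mul_eq_mul_div, div_eq_inv_mul]
  refine mul_le_mul_of_nonneg_left ?_ (by positivity)
  linarith

theorem tendsto_two_mul_one_sub_cos_div_sq :
    Filter.Tendsto (fun n : ℕ => 2 * (1 - Real.cos (1 / ((n : ℝ) + 1))) / (1 / ((n : ℝ) + 1)) ^ 2)
      Filter.atTop (nhds 1) := by
  have h4 : Filter.Tendsto (fun n : ℕ => 1 / ((n : ℝ) + 1) / 2) Filter.atTop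
      (nhdsWithin 0 {0}ᶜ) :=
    tendsto_nhdsWithin_iff.2 ⟨by
        simpa using tendsto_one_div_add_atTop_nhds_zero_nat.div_const (2 : ℝ),
      Filter.Eventually.of_forall fun n => by
        have : (0 : ℝ) < 1 / ((n : ℝ) + 1) / 2 := by positivity
        exact this.ne'⟩
  have h5 := ((hasDerivAt_iff_tendsto_slope_zero.1 (Real.hasDerivAt_sin 0)).comp h4).pow 2
  simp only [Real.cos_zero, one_pow] at h5
  refine h5.congr fun n => ?_
  have ht : (0 : ℝ) < 1 / ((n : ℝ) + 1) := by positivity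
  simp only [Function.comp_apply, zero_add, Real.sin_zero, sub_zero, smul_eq_mul]
  set t := 1 / ((n : ℝ) + 1)
  have h6 : Real.cos t = 1 - 2 * Real.sin (t / 2) ^ 2 := by
    have := Real.cos_two_mul (t / 2)
    rw [mul_div_cancel₀ t two_ne_zero] at this
    rw [this, Real.cos_sq']
    ring
  rw [h6]
  field_simp
  ring

/-- The Gaussian Poincaré inequality for a mean-zero Lipschitz function. -/
theorem LipschitzWith.integral_sq_le_of_integral_eq_zero {f : E → ℝ} {L : NNReal}
    (hf : LipschitzWith L f) (hmean : ∫ x, f x ∂stdGaussian E = 0) :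
    ∫ x, f x ^ 2 ∂stdGaussian E ≤ (L : ℝ) ^ 2 := by
  have hn : MemLp (fun x : E => ‖x‖) 2 (stdGaussian E) := IsGaussian.memLp_two_id.norm
  have hn1 : MemLp (fun p : E × E => ‖p.1‖) 2 ((stdGaussian E).prod (stdGaussian E)) :=
    hn.comp_measurePreserving measurePreserving_fst
  have hn2 : MemLp (fun p : E × E => ‖p.2‖) 2 ((stdGaussian E).prod (stdGaussian E)) :=
    hn.comp_measurePreserving measurePreserving_snd
  have hbi : Integrable (fun p : E × E => (L * (‖p.1‖ + ‖p.2‖)) ^ 2)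
      ((stdGaussian E).prod (stdGaussian E)) :=
    ((hn1.add hn2).const_mul (L : ℝ)).integrable_sq
  have hcont : ∀ n, Continuous (rotationQuotient f n) := fun n =>
    continuous_const.mul ((hf.continuous.comp (by fun_prop)).sub
      (hf.continuous.comp continuous_fst))
  have hbound : ∀ n, ∀ p : E × E, ‖rotationQuotient f n p ^ 2‖ ≤ (L * (‖p.1‖ + ‖p.2‖)) ^ 2 :=
    fun n p => by
      rw [norm_pow, Real.norm_eq_abs]
      exact pow_le_pow_left₀ (abs_nonneg _) (hf.abs_rotationQuotient_le n p) 2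
  have hdiff : ∀ᵐ x ∂stdGaussian E, DifferentiableAt ℝ f x :=
    stdGaussian_absolutelyContinuous.ae_le hf.ae_differentiableAt
  have hlim : ∀ᵐ p : E × E ∂(stdGaussian E).prod (stdGaussian E),
      Filter.Tendsto (fun n => rotationQuotient f n p ^ 2) Filter.atTop
        (nhds (fderiv ℝ f p.1 p.2 ^ 2)) := by
    filter_upwards [measurePreserving_fst.quasiMeasurePreserving.ae hdiff] with p hp
    exact (tendsto_rotationQuotient hp p.2).pow 2
  have hmeas : ∀ n, AEStronglyMeasurable (fun p => rotationQuotient f n p ^ 2)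
      ((stdGaussian E).prod (stdGaussian E)) := fun n =>
    ((hcont n).pow 2).aestronglyMeasurable
  have hconv := tendsto_integral_of_dominated_convergence _ hmeas hbi
    (fun n => ae_of_all _ (hbound n)) hlim
  have hle := le_of_tendsto_of_tendsto'
    (tendsto_two_mul_one_sub_cos_div_sq.mul_const (∫ x, f x ^ 2 ∂stdGaussian E)) hconv
    (hf.mul_integral_sq_le_integral_sq_rotationQuotient hmean)
  rw [one_mul] at hle
  refine hle.trans ?_
  have hint : Integrable (fun p : E × E => fderiv ℝ f p.1 p.2 ^ 2)
      ((stdGaussian E).prod (stdGaussian E)) := by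
    refine hbi.mono' (aestronglyMeasurable_of_tendsto_ae _ hmeas hlim) ?_
    filter_upwards [hlim] with p hp
    exact le_of_tendsto' hp.norm fun n => hbound n p
  rw [integral_prod _ hint]
  simp_rw [integral_sq_strongDual_stdGaussian]
  calc ∫ x, ‖fderiv ℝ f x‖ ^ 2 ∂stdGaussian E ≤ ∫ _, (L : ℝ) ^ 2 ∂stdGaussian E :=
        integral_mono_of_nonneg (ae_of_all _ fun x => by positivity) (integrable_const _)
          (ae_of_all _ fun x =>
            pow_le_pow_left₀ (norm_nonneg _) (norm_fderiv_le_of_lipschitz ℝ hf) 2)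
    _ = (L : ℝ) ^ 2 := by simp

/-- Gaussian covariance bound for two Lipschitz functions. -/
theorem LipschitzWith.abs_integral_mul_sub_le {f g : E → ℝ} {L M : NNReal}
    (hf : LipschitzWith L f) (hg : LipschitzWith M g) :
    |∫ x, f x * g x ∂stdGaussian E - (∫ x, f x ∂stdGaussian E) * ∫ x, g x ∂stdGaussian E| ≤
      L * M := by
  set a := ∫ x, f x ∂stdGaussian E with ha
  set b := ∫ x, g x ∂stdGaussian E with hb
  have hf' : LipschitzWith L fun x => f x - a :=
    LipschitzWith.of_dist_le_mul fun x y => by simpa using hf.dist_le_mul x y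
  have hg' : LipschitzWith M fun x => g x - b :=
    LipschitzWith.of_dist_le_mul fun x y => by simpa using hg.dist_le_mul x y
  have hfi := hf.integrable_stdGaussian
  have hgi := hg.integrable_stdGaussian
  have hfg : Integrable (fun x => f x * g x) (stdGaussian E) :=
    hf.memLp_two_stdGaussian.integrable_mul hg.memLp_two_stdGaussian
  have h1 : ∫ x, (f x - a) ^ 2 ∂stdGaussian E ≤ (L : ℝ) ^ 2 :=
    hf'.integral_sq_le_of_integral_eq_zero (by
      rw [integral_sub hfi (integrable_const _), ← ha]; simp)
  have h2 : ∫ x, (g x - b) ^ 2 ∂stdGaussian E ≤ (M : ℝ) ^ 2 :=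
    hg'.integral_sq_le_of_integral_eq_zero (by
      rw [integral_sub hgi (integrable_const _), ← hb]; simp)
  have h3 : ∫ x, f x * g x ∂stdGaussian E - a * b =
      ∫ x, (f x - a) * (g x - b) ∂stdGaussian E := by
    have h4 : ∀ x, (f x - a) * (g x - b) = f x * g x - (b * f x + a * g x) + a * b :=
      fun x => by ring
    have h5 : Integrable (fun x => b * f x + a * g x) (stdGaussian E) :=
      (hfi.const_mul b).add (hgi.const_mul a)
    have h6 : Integrable (fun x => f x * g x - (b * f x + a * g x)) (stdGaussian E) := hfg.sub h5
    simp_rw [h4]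
    rw [integral_add h6 (integrable_const _), integral_sub hfg h5,
      integral_add (hfi.const_mul b) (hgi.const_mul a), integral_const_mul, integral_const_mul,
      ← ha, ← hb]
    simp
    ring
  rw [h3]
  refine abs_le_of_sq_le_sq ?_ (by positivity)
  rw [mul_pow]
  refine (sq_integral_mul_le hf'.memLp_two_stdGaussian hg'.memLp_two_stdGaussian).trans ?_
  exact mul_le_mul h1 h2 (integral_nonneg fun x => sq_nonneg _) (by positivity)

end Gaussian

/-! ### Euclidean projections onto closed convex sets -/

section Projection

variable {d : ℕ} {C : Set (EuclideanSpace ℝ (Fin d))}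

theorem inner_sub_proj_le_zero (hne : C.Nonempty) (hcl : IsClosed C) (hconv : Convex ℝ C)
    (u : EuclideanSpace ℝ (Fin d)) {z : EuclideanSpace ℝ (Fin d)} (hz : z ∈ C) :
    inner ℝ (u - proj C u) (z - proj C u) ≤ 0 := by
  obtain ⟨hp, hmin⟩ := proj_spec hne hcl hconv u
  have : Nonempty C := hne.to_subtype
  refine (norm_eq_iInf_iff_real_inner_le_zero hconv hp).1 (le_antisymm ?_ ?_) z hz
  · exact le_ciInf fun w => le_of_sq_le_sq (hmin w w.2) (norm_nonneg _)
  · exact ciInf_le (f := fun w : C => ‖u - w‖)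
      ⟨0, Set.forall_mem_range.2 fun w => norm_nonneg _⟩ ⟨_, hp⟩

theorem infDist_eq_norm_sub_proj (hne : C.Nonempty) (hcl : IsClosed C) (hconv : Convex ℝ C)
    (u : EuclideanSpace ℝ (Fin d)) : Metric.infDist u C = ‖u - proj C u‖ := by
  obtain ⟨hp, hmin⟩ := proj_spec hne hcl hconv u
  refine le_antisymm ?_ ?_
  · rw [← dist_eq_norm]
    exact Metric.infDist_le_dist_of_mem hp
  · refine (Metric.le_infDist hne).2 fun z hz => ?_
    rw [dist_eq_norm]
    exact le_of_sq_le_sq (hmin z hz) (norm_nonneg _)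

theorem norm_proj_sub_proj_sq_le (hne : C.Nonempty) (hcl : IsClosed C) (hconv : Convex ℝ C)
    (u v : EuclideanSpace ℝ (Fin d)) :
    ‖proj C u - proj C v‖ ^ 2 ≤ inner ℝ (u - v) (proj C u - proj C v) := by
  have h1 := inner_sub_proj_le_zero hne hcl hconv u (proj_spec hne hcl hconv v).1
  have h2 := inner_sub_proj_le_zero hne hcl hconv v (proj_spec hne hcl hconv u).1
  rw [← real_inner_self_eq_norm_sq]
  simp only [inner_sub_left, inner_sub_right] at *
  linarith

theorem lipschitzWith_proj (hne : C.Nonempty) (hcl : IsClosed C) (hconv : Convex ℝ C) :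
    LipschitzWith 1 (proj C) := by
  refine LipschitzWith.of_dist_le_mul fun u v => ?_
  rw [dist_eq_norm, dist_eq_norm, NNReal.coe_one, one_mul]
  have h1 := norm_proj_sub_proj_sq_le hne hcl hconv u v
  have h2 := real_inner_le_norm (u - v) (proj C u - proj C v)
  by_contra! hlt
  have h3 := (norm_nonneg (u - v)).trans_lt hlt
  nlinarith

theorem lipschitzWith_sub_proj (hne : C.Nonempty) (hcl : IsClosed C) (hconv : Convex ℝ C) :
    LipschitzWith 1 (fun u => u - proj C u) := by
  refine LipschitzWith.of_dist_le_mul fun u v => ?_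
  rw [dist_eq_norm, dist_eq_norm, NNReal.coe_one, one_mul]
  have h1 := norm_proj_sub_proj_sq_le hne hcl hconv u v
  have h2 : u - proj C u - (v - proj C v) = (u - v) - (proj C u - proj C v) := by abel
  refine le_of_sq_le_sq ?_ (norm_nonneg _)
  rw [h2, norm_sub_sq_real]
  nlinarith [sq_nonneg ‖proj C u - proj C v‖]

end Projection

/-! ### Dilates of a compact convex set -/

section Dilates

variable {d : ℕ} {S : Set (EuclideanSpace ℝ (Fin d))}

/-- The support function of a set. -/
noncomputable def supportFunction (S : Set (EuclideanSpace ℝ (Fin d)))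
    (w : EuclideanSpace ℝ (Fin d)) : ℝ :=
  sSup ((fun s => inner ℝ s w) '' S)

theorem isCompact_image_inner (hS : IsCompact S) (w : EuclideanSpace ℝ (Fin d)) :
    IsCompact ((fun s => inner ℝ s w) '' S) :=
  hS.image (by fun_prop)

theorem inner_le_supportFunction (hS : IsCompact S) (w : EuclideanSpace ℝ (Fin d))
    {s : EuclideanSpace ℝ (Fin d)} (hs : s ∈ S) : inner ℝ s w ≤ supportFunction S w :=
  le_csSup (isCompact_image_inner hS w).bddAbove (Set.mem_image_of_mem _ hs)

theorem exists_inner_eq_supportFunction (hS : IsCompact S) (hne : S.Nonempty)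
    (w : EuclideanSpace ℝ (Fin d)) : ∃ s ∈ S, inner ℝ s w = supportFunction S w :=
  (isCompact_image_inner hS w).sSup_mem (hne.image _)

theorem lipschitzWith_supportFunction (hS : IsCompact S) (hne : S.Nonempty) {R : NNReal}
    (hR : ∀ s ∈ S, ‖s‖ ≤ R) : LipschitzWith R (supportFunction S) := by
  refine LipschitzWith.of_le_add_mul R fun w w' => ?_
  obtain ⟨s, hs, hsw⟩ := exists_inner_eq_supportFunction hS hne w
  have h1 := inner_le_supportFunction hS w' hs
  have h2 : inner ℝ s (w - w') ≤ R * dist w w' := by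
    rw [dist_eq_norm]
    exact (real_inner_le_norm _ _).trans (mul_le_mul_of_nonneg_right (hR s hs) (norm_nonneg _))
  rw [inner_sub_right] at h2
  linarith

/-- The residual of the projection onto the dilate `τ • S`. -/
noncomputable def projResidual (S : Set (EuclideanSpace ℝ (Fin d))) (τ : ℝ)
    (u : EuclideanSpace ℝ (Fin d)) : EuclideanSpace ℝ (Fin d) :=
  u - proj (τ • S) u

/-- The projection onto `τ • S` is `τ • s` for a point `s ∈ S` that maximizes the inner product with
the residual. -/
theorem exists_proj_smul_eq (hS : IsCompact S) (hne : S.Nonempty) (hconv : Convex ℝ S) {τ : ℝ}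
    (hτ : 0 ≤ τ) (u : EuclideanSpace ℝ (Fin d)) :
    ∃ s ∈ S, proj (τ • S) u = τ • s ∧
      inner ℝ s (projResidual S τ u) = supportFunction S (projResidual S τ u) := by
  have hne' : (τ • S).Nonempty := hne.smul_set
  have hcl : IsClosed (τ • S) := (hS.smul τ).isClosed
  have hconv' : Convex ℝ (τ • S) := hconv.smul τ
  obtain ⟨s₀, hs₀, hsp⟩ := (proj_spec hne' hcl hconv' u).1
  obtain ⟨s₁, hs₁, hsw⟩ := exists_inner_eq_supportFunction hS hne (projResidual S τ u)
  dsimp only at hsp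
  -- For `τ > 0` the projection determines `s`; for `τ = 0` any maximizer does.
  rcases hτ.eq_or_lt with h0 | hpos
  · refine ⟨s₁, hs₁, ?_, hsw⟩
    rw [← hsp, ← h0, zero_smul, zero_smul]
  · refine ⟨s₀, hs₀, hsp.symm, le_antisymm (inner_le_supportFunction hS _ hs₀) ?_⟩
    have h1 := inner_sub_proj_le_zero hne' hcl hconv' u (Set.smul_mem_smul_set (a := τ) hs₁)
    have h2 : τ • s₁ - proj (τ • S) u = τ • (s₁ - s₀) := by rw [← hsp, smul_sub]
    rw [h2, inner_smul_right, inner_sub_right, real_inner_comm, real_inner_comm s₀] at h1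
    have h3 : inner ℝ s₁ (projResidual S τ u) - inner ℝ s₀ (projResidual S τ u) ≤ 0 :=
      nonpos_of_mul_nonpos_right h1 hpos
    linarith

theorem sq_norm_projResidual_le (hS : IsCompact S) (hne : S.Nonempty) (hconv : Convex ℝ S) {τ : ℝ}
    (u : EuclideanSpace ℝ (Fin d)) {s : EuclideanSpace ℝ (Fin d)} (hs : s ∈ S) :
    ‖projResidual S τ u‖ ^ 2 ≤ ‖u - τ • s‖ ^ 2 :=
  (proj_spec hne.smul_set (hS.smul τ).isClosed (hconv.smul τ) u).2 _ (Set.smul_mem_smul_set hs)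

/-- The squared distance lies below a quadratic in the dilation factor `τ'`, obtained by testing the
distance to `τ' • S` with the maximizing point `s ∈ S` found at `τ`. -/
theorem sq_norm_projResidual_le_add (hS : IsCompact S) (hne : S.Nonempty) (hconv : Convex ℝ S)
    {R : ℝ} (hR : ∀ s ∈ S, ‖s‖ ≤ R) {τ : ℝ} (hτ : 0 ≤ τ) (τ' : ℝ)
    (u : EuclideanSpace ℝ (Fin d)) :
    ‖projResidual S τ' u‖ ^ 2 ≤ ‖projResidual S τ u‖ ^ 2 -
      2 * (τ' - τ) * supportFunction S (projResidual S τ u) + (τ' - τ) ^ 2 * R ^ 2 := by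
  obtain ⟨s, hs, hp, hsw⟩ := exists_proj_smul_eq hS hne hconv hτ u
  refine (sq_norm_projResidual_le hS hne hconv u hs).trans ?_
  have h1 : u - τ' • s = projResidual S τ u - (τ' - τ) • s := by
    rw [projResidual, hp]
    module
  rw [h1, norm_sub_sq_real, inner_smul_right, real_inner_comm, hsw, norm_smul, mul_pow,
    Real.norm_eq_abs, sq_abs]
  have h2 : ‖s‖ ^ 2 ≤ R ^ 2 := pow_le_pow_left₀ (norm_nonneg _) (hR s hs) 2
  nlinarith [mul_le_mul_of_nonneg_left h2 (sq_nonneg (τ' - τ))]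

/-- Convexity of the squared distance in the dilation factor. -/
theorem sq_norm_projResidual_sub_le (hS : IsCompact S) (hne : S.Nonempty) (hconv : Convex ℝ S)
    {τ τ' : ℝ} (hτ : 0 ≤ τ) (hτ' : 0 ≤ τ') (u : EuclideanSpace ℝ (Fin d))
    {s' : EuclideanSpace ℝ (Fin d)} (hs' : s' ∈ S) :
    ‖projResidual S τ u‖ ^ 2 - 2 * (τ' - τ) * supportFunction S (projResidual S τ u) ≤
      ‖u - τ' • s'‖ ^ 2 := by
  obtain ⟨s, hs, hp, hsw⟩ := exists_proj_smul_eq hS hne hconv hτ u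
  have h1 : u - τ' • s' = projResidual S τ u - (τ' • s' - τ • s) := by
    rw [projResidual, hp]
    module
  rw [h1, norm_sub_sq_real, inner_sub_right, inner_smul_right, inner_smul_right, real_inner_comm,
    real_inner_comm s, hsw]
  have h2 := mul_le_mul_of_nonneg_left (inner_le_supportFunction hS (projResidual S τ u) hs') hτ'
  nlinarith [sq_nonneg ‖τ' • s' - τ • s‖]

theorem lipschitzWith_projResidual (hS : IsCompact S) (hne : S.Nonempty) (hconv : Convex ℝ S)
    (τ : ℝ) : LipschitzWith 1 (projResidual S τ) :=
  lipschitzWith_sub_proj hne.smul_set (hS.smul τ).isClosed (hconv.smul τ)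

theorem lipschitzWith_supportFunction_projResidual (hS : IsCompact S) (hne : S.Nonempty)
    (hconv : Convex ℝ S) {R : NNReal} (hR : ∀ s ∈ S, ‖s‖ ≤ R) (τ : ℝ) :
    LipschitzWith R (fun u => supportFunction S (projResidual S τ u)) := by
  simpa [Function.comp_def] using
    (lipschitzWith_supportFunction hS hne hR).comp (lipschitzWith_projResidual hS hne hconv τ)

theorem LipschitzWith.integrable_sq_norm_stdGaussian
    {h : EuclideanSpace ℝ (Fin d) → EuclideanSpace ℝ (Fin d)} {L : NNReal}
    (hh : LipschitzWith L h) :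
    Integrable (fun u => ‖h u‖ ^ 2) (stdGaussian (EuclideanSpace ℝ (Fin d))) :=
  (lipschitzWith_one_norm.comp hh).memLp_two_stdGaussian.integrable_sq

theorem integrable_sq_projResidual (hS : IsCompact S) (hne : S.Nonempty) (hconv : Convex ℝ S)
    (τ : ℝ) : Integrable (fun u => ‖projResidual S τ u‖ ^ 2)
      (stdGaussian (EuclideanSpace ℝ (Fin d))) :=
  (lipschitzWith_projResidual hS hne hconv τ).integrable_sq_norm_stdGaussian

theorem infDist_smul_eq_norm_projResidual (hS : IsCompact S) (hne : S.Nonempty) (hconv : Convex ℝ S)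
    (τ : ℝ) (u : EuclideanSpace ℝ (Fin d)) : Metric.infDist u (τ • S) = ‖projResidual S τ u‖ :=
  infDist_eq_norm_sub_proj hne.smul_set (hS.smul τ).isClosed (hconv.smul τ) u

theorem expectedSqDist_eq (hS : IsCompact S) (hne : S.Nonempty) (hconv : Convex ℝ S) (τ : ℝ) :
    expectedSqDist S τ = ∫ u, ‖projResidual S τ u‖ ^ 2 ∂stdGaussian (EuclideanSpace ℝ (Fin d)) := by
  rw [expectedSqDist]
  simp_rw [infDist_smul_eq_norm_projResidual hS hne hconv]

/-- The mean of the support function at the residual: up to the factor `-2`, the derivative of the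
expected squared distance with respect to the dilation factor. -/
noncomputable def meanSupport (S : Set (EuclideanSpace ℝ (Fin d))) (τ : ℝ) : ℝ :=
  ∫ u, supportFunction S (projResidual S τ u) ∂stdGaussian (EuclideanSpace ℝ (Fin d))

theorem expectedSqDist_le_add (hS : IsCompact S) (hne : S.Nonempty) (hconv : Convex ℝ S)
    {R : NNReal} (hR : ∀ s ∈ S, ‖s‖ ≤ R) {τ : ℝ} (hτ : 0 ≤ τ) (τ' : ℝ) :
    expectedSqDist S τ' ≤ expectedSqDist S τ - 2 * (τ' - τ) * meanSupport S τ +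
      (τ' - τ) ^ 2 * R ^ 2 := by
  have hi := (lipschitzWith_supportFunction_projResidual hS hne hconv hR τ).integrable_stdGaussian
  have h1 := integrable_sq_projResidual hS hne hconv τ
  have h2 := integrable_sq_projResidual hS hne hconv τ'
  have h3 := h1.sub (hi.const_mul (2 * (τ' - τ)))
  have h4 := integral_mono h2 (h3.add (integrable_const ((τ' - τ) ^ 2 * (R : ℝ) ^ 2)))
    fun u => sq_norm_projResidual_le_add hS hne hconv hR hτ τ' u
  rw [integral_add' h3 (integrable_const _), integral_sub' h1 (hi.const_mul _),
    integral_const_mul, ← expectedSqDist_eq hS hne hconv, ← expectedSqDist_eq hS hne hconv] at h4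
  simpa [meanSupport] using h4

theorem expectedSqDist_sub_le (hS : IsCompact S) (hne : S.Nonempty) (hconv : Convex ℝ S)
    {R : NNReal} (hR : ∀ s ∈ S, ‖s‖ ≤ R) {τ τ' : ℝ} (hτ : 0 ≤ τ) (hτ' : 0 ≤ τ') :
    expectedSqDist S τ - 2 * (τ' - τ) * meanSupport S τ ≤ expectedSqDist S τ' := by
  have hi := (lipschitzWith_supportFunction_projResidual hS hne hconv hR τ).integrable_stdGaussian
  have h1 := integrable_sq_projResidual hS hne hconv τ
  have h2 := integrable_sq_projResidual hS hne hconv τ'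
  have h3 := h1.sub (hi.const_mul (2 * (τ' - τ)))
  have h4 := integral_mono h3 h2 fun u => by
    obtain ⟨s', hs', hp, -⟩ := exists_proj_smul_eq hS hne hconv hτ' u
    have := sq_norm_projResidual_sub_le hS hne hconv hτ hτ' u hs'
    rwa [← hp] at this
  rw [integral_sub' h1 (hi.const_mul _), integral_const_mul, ← expectedSqDist_eq hS hne hconv,
    ← expectedSqDist_eq hS hne hconv] at h4
  exact h4

/-- At each `τ ≥ 0` the expected squared distance is squeezed between an affine and a quadratic
function that touch it there. -/
theorem continuousOn_expectedSqDist (hS : IsCompact S) (hne : S.Nonempty) (hconv : Convex ℝ S)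
    {R : NNReal} (hR : ∀ s ∈ S, ‖s‖ ≤ R) : ContinuousOn (expectedSqDist S) (Set.Ici 0) := by
  intro τ hτ
  have h1 : Filter.Tendsto (fun τ' => expectedSqDist S τ - 2 * (τ' - τ) * meanSupport S τ)
      (nhdsWithin τ (Set.Ici 0)) (nhds (expectedSqDist S τ)) := by
    have : Continuous fun τ' => expectedSqDist S τ - 2 * (τ' - τ) * meanSupport S τ := by fun_prop
    simpa using this.continuousWithinAt (s := Set.Ici 0) (x := τ) |>.tendsto
  have h2 : Filter.Tendsto (fun τ' => expectedSqDist S τ - 2 * (τ' - τ) * meanSupport S τ +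
      (τ' - τ) ^ 2 * R ^ 2) (nhdsWithin τ (Set.Ici 0)) (nhds (expectedSqDist S τ)) := by
    have : Continuous fun τ' => expectedSqDist S τ - 2 * (τ' - τ) * meanSupport S τ +
      (τ' - τ) ^ 2 * (R : ℝ) ^ 2 := by fun_prop
    simpa using this.continuousWithinAt (s := Set.Ici 0) (x := τ) |>.tendsto
  refine tendsto_of_tendsto_of_tendsto_of_le_of_le' h1 h2 ?_ ?_
  · filter_upwards [self_mem_nhdsWithin] with τ' hτ'
    exact expectedSqDist_sub_le hS hne hconv hR hτ hτ'
  · exact Filter.Eventually.of_forall fun τ' => expectedSqDist_le_add hS hne hconv hR hτ τ'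

/-- Coercivity of the expected squared distance in the dilation factor. -/
theorem le_expectedSqDist (hS : IsCompact S) (hne : S.Nonempty) (hconv : Convex ℝ S) {m : ℝ}
    (hm0 : 0 ≤ m) (hm : ∀ s ∈ S, m ≤ ‖s‖) {τ : ℝ} (hτ : 0 ≤ τ) :
    (τ * m) ^ 2 / 2 - ∫ u, ‖u‖ ^ 2 ∂stdGaussian (EuclideanSpace ℝ (Fin d)) ≤
      expectedSqDist S τ := by
  have hi : Integrable (fun u : EuclideanSpace ℝ (Fin d) => ‖u‖ ^ 2) (stdGaussian _) :=
    LipschitzWith.id.integrable_sq_norm_stdGaussian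
  have h := integral_mono ((integrable_const ((τ * m) ^ 2 / 2)).sub hi)
    (integrable_sq_projResidual hS hne hconv τ) fun u => by
      obtain ⟨s, hs, hp, -⟩ := exists_proj_smul_eq hS hne hconv hτ u
      have h1 : τ * m ≤ ‖projResidual S τ u‖ + ‖u‖ := by
        calc τ * m ≤ τ * ‖s‖ := by gcongr; exact hm s hs
          _ = ‖u - projResidual S τ u‖ := by
              rw [projResidual, hp, sub_sub_cancel, norm_smul, Real.norm_of_nonneg hτ]
          _ ≤ _ := (norm_sub_le _ _).trans_eq (add_comm _ _)
      have h2 : (τ * m) ^ 2 ≤ (‖projResidual S τ u‖ + ‖u‖) ^ 2 :=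
        pow_le_pow_left₀ (by positivity) h1 2
      change (τ * m) ^ 2 / 2 - ‖u‖ ^ 2 ≤ ‖projResidual S τ u‖ ^ 2
      nlinarith [sq_nonneg (‖projResidual S τ u‖ - ‖u‖)]
  rw [integral_sub' (integrable_const _) hi, ← expectedSqDist_eq hS hne hconv] at h
  simpa using h

theorem exists_forall_expectedSqDist_le (hS : IsCompact S) (hne : S.Nonempty)
    (hconv : Convex ℝ S) {R : NNReal} (hR : ∀ s ∈ S, ‖s‖ ≤ R) {m : ℝ} (hm0 : 0 < m)
    (hm : ∀ s ∈ S, m ≤ ‖s‖) :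
    ∃ τ, 0 ≤ τ ∧ ∀ τ', 0 ≤ τ' → expectedSqDist S τ ≤ expectedSqDist S τ' := by
  have htend : Filter.Tendsto (fun τ : ℝ => (τ * m) ^ 2 / 2 -
      ∫ u, ‖u‖ ^ 2 ∂stdGaussian (EuclideanSpace ℝ (Fin d))) Filter.atTop Filter.atTop := by
    refine Filter.tendsto_atTop_add_const_right _ _ (Filter.Tendsto.atTop_div_const two_pos ?_)
    exact (Filter.tendsto_pow_atTop two_ne_zero).comp
      (Filter.tendsto_id.atTop_mul_const hm0)
  obtain ⟨T, hT⟩ := Filter.eventually_atTop.1 (htend.eventually_ge_atTop (expectedSqDist S 0))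
  obtain ⟨τ, hτ, hmin⟩ := isCompact_Icc.exists_isMinOn (⟨0, by simp⟩ : (Set.Icc 0 |T|).Nonempty)
    ((continuousOn_expectedSqDist hS hne hconv hR).mono Set.Icc_subset_Ici_self)
  refine ⟨τ, hτ.1, fun τ' hτ' => ?_⟩
  rcases le_total τ' |T| with h | h
  · exact hmin ⟨hτ', h⟩
  · exact (hmin ⟨le_rfl, abs_nonneg T⟩).trans ((hT τ' ((le_abs_self T).trans h)).trans
      (le_expectedSqDist hS hne hconv hm0.le hm hτ'))

/-- First-order optimality at a minimizer of the expected squared distance. -/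
theorem mul_meanSupport_nonpos (hS : IsCompact S) (hne : S.Nonempty)
    (hconv : Convex ℝ S) {R : NNReal} (hR : ∀ s ∈ S, ‖s‖ ≤ R) {τ : ℝ} (hτ : 0 ≤ τ)
    (hmin : ∀ τ', 0 ≤ τ' → expectedSqDist S τ ≤ expectedSqDist S τ') {τ' : ℝ} (hτ' : 0 ≤ τ') :
    (τ' - τ) * meanSupport S τ ≤ 0 := by
  -- Comparing with `τ + ε (τ' - τ)` gives `2 a ≤ ε b`, which fails for small `ε` if `a > 0`.
  by_contra! hpos
  set a := (τ' - τ) * meanSupport S τ with ha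
  set b := (τ' - τ) ^ 2 * (R : ℝ) ^ 2 with hb
  have hb0 : 0 ≤ b := by positivity
  have hab : 0 < a + b := by linarith
  have key : ∀ ε, 0 < ε → ε ≤ 1 → 2 * a ≤ ε * b := fun ε h0 h1 => by
    have h2 : 0 ≤ τ + ε * (τ' - τ) := by nlinarith
    have h3 := (hmin _ h2).trans (expectedSqDist_le_add hS hne hconv hR hτ _)
    have h4 : ε * (2 * a) ≤ ε * (ε * b) := by
      rw [ha, hb]
      nlinarith
    exact le_of_mul_le_mul_left h4 h0
  have h5 := key (a / (a + b)) (by positivity) ((div_le_one hab).2 (by linarith))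
  have h6 : a / (a + b) * b ≤ a := by
    rw [div_mul_eq_mul_div, div_le_iff₀ hab]
    nlinarith [mul_pos hpos hpos]
  linarith

end Dilates

/-! ### The subdifferential of a norm and its polar cone -/

section Subdifferential

variable {d : ℕ} {f : Seminorm ℝ (EuclideanSpace ℝ (Fin d))} {x : EuclideanSpace ℝ (Fin d)}

theorem Seminorm.continuous_euclideanSpace (f : Seminorm ℝ (EuclideanSpace ℝ (Fin d))) :
    Continuous f :=
  f.convexOn.locallyLipschitz.continuous

theorem mem_subdifferential_iff {u : EuclideanSpace ℝ (Fin d)} :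
    u ∈ subdifferential f x ↔ (∀ z, inner ℝ u z ≤ f z) ∧ inner ℝ u x = f x := by
  constructor
  · intro hu
    have hx : inner ℝ u x = f x := by
      have h0 := hu 0
      have h2 := hu ((2 : ℝ) • x)
      rw [map_zero, zero_sub, inner_neg_right] at h0
      rw [map_smul_eq_mul, two_smul, add_sub_cancel_right] at h2
      norm_num at h2
      linarith
    refine ⟨fun z => ?_, hx⟩
    have hz := hu z
    rw [inner_sub_right, hx] at hz
    linarith
  · rintro ⟨h1, h2⟩ y
    rw [inner_sub_right, h2]
    linarith [h1 y]

theorem isClosed_subdifferential : IsClosed (subdifferential f x) := by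
  simp only [subdifferential, Set.ofPred_forall]
  exact isClosed_iInter fun y => isClosed_le (by fun_prop) continuous_const

theorem convex_subdifferential : Convex ℝ (subdifferential f x) := by
  intro u hu v hv a b ha hb hab y
  rw [inner_add_left, real_inner_smul_left, real_inner_smul_left]
  have h1 := add_le_add (mul_le_mul_of_nonneg_left (hu y) ha)
    (mul_le_mul_of_nonneg_left (hv y) hb)
  have h2 : f y = a * f y + b * f y := by rw [← add_mul, hab, one_mul]
  have h3 : f x = a * f x + b * f x := by rw [← add_mul, hab, one_mul]
  linarith

theorem isBounded_subdifferential : Bornology.IsBounded (subdifferential f x) := by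
  obtain ⟨M, hM0, hM⟩ := Seminorm.bound_of_continuous_normedSpace f f.continuous_euclideanSpace
  refine isBounded_iff_forall_norm_le.2 ⟨M, fun u hu => ?_⟩
  have h := ((mem_subdifferential_iff.1 hu).1 u).trans (hM u)
  rw [real_inner_self_eq_norm_sq] at h
  by_contra! hlt
  nlinarith

theorem isCompact_subdifferential : IsCompact (subdifferential f x) :=
  Metric.isCompact_of_isClosed_isBounded isClosed_subdifferential isBounded_subdifferential

/-- A direction outside the descent cone has nonnegative inner product with some subgradient: the
functional separating the ray `x + τ • y` from the open sublevel set of `f` is, after scaling, a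
subgradient. -/
theorem exists_mem_subdifferential_of_notMem_descentCone (hfx : 0 < f x)
    {y : EuclideanSpace ℝ (Fin d)} (hy : y ∉ descentCone f x) :
    ∃ s ∈ subdifferential f x, 0 ≤ inner ℝ s y := by
  have hdesc : ∀ τ : ℝ, 0 < τ → f x < f (x + τ • y) := fun τ hτ => by
    by_contra! h
    exact hy ⟨τ, hτ, h⟩
  have hball : f.ball 0 (f x) = {z | f z < f x} := by
    ext z
    rw [Seminorm.mem_ball_zero]
    rfl
  have hconv : Convex ℝ {z | f z < f x} := hball ▸ f.convex_ball 0 (f x)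
  have hopen : IsOpen {z | f z < f x} :=
    isOpen_lt f.continuous_euclideanSpace continuous_const
  have hray : Convex ℝ ((fun τ : ℝ => x + τ • y) '' Set.Ici 0) := by
    rintro _ ⟨τ, hτ, rfl⟩ _ ⟨σ, hσ, rfl⟩ a b ha hb hab
    refine ⟨a * τ + b * σ, add_nonneg (mul_nonneg ha hτ) (mul_nonneg hb hσ), ?_⟩
    have : x = (a + b) • x := by rw [hab, one_smul]
    dsimp only
    nth_rw 1 [this]
    module
  have hdisj : Disjoint {z | f z < f x} ((fun τ : ℝ => x + τ • y) '' Set.Ici 0) := by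
    rw [Set.disjoint_right]
    rintro _ ⟨τ, hτ, rfl⟩ hlt
    rcases (Set.mem_Ici.1 hτ).eq_or_lt with h0 | hpos
    · simp [← h0] at hlt
    · exact lt_asymm hlt (hdesc τ hpos)
  obtain ⟨ℓ, c, hc1, hc2⟩ := geometric_hahn_banach_open hconv hopen hray hdisj
  have hray' : ∀ τ : ℝ, 0 ≤ τ → c ≤ ℓ x + τ * ℓ y := fun τ hτ => by
    have := hc2 _ (Set.mem_image_of_mem _ hτ)
    simpa using this
  have hc0 : 0 < c := by
    have := hc1 0 (by simpa using hfx)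
    simpa using this
  have hcx : c ≤ ℓ x := by simpa using hray' 0 le_rfl
  have hx0 : 0 < ℓ x := hc0.trans_le hcx
  have hy0 : 0 ≤ ℓ y := by
    by_contra! hneg
    have := hray' (ℓ x / -ℓ y) (div_nonneg hx0.le (by linarith))
    rw [div_mul_eq_mul_div, mul_div_assoc, div_neg, div_self hneg.ne] at this
    linarith
  have hle : ∀ z, f x * ℓ z ≤ ℓ x * f z := fun z => by
    by_contra! hlt
    have hz0 : 0 < ℓ z := by
      have h1 : 0 ≤ ℓ x * f z := mul_nonneg hx0.le (apply_nonneg f z)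
      exact pos_of_mul_pos_right (h1.trans_lt hlt) hfx.le
    -- The multiple of `z` at height `ℓ x` lies in the open sublevel set.
    have h1 : f ((ℓ x / ℓ z) • z) < f x := by
      rw [map_smul_eq_mul, Real.norm_of_nonneg (by positivity), div_mul_eq_mul_div,
        div_lt_iff₀ hz0]
      exact hlt
    have h2 := hc1 _ h1
    rw [map_smul, smul_eq_mul, div_mul_cancel₀ _ hz0.ne'] at h2
    linarith
  have hinner : ∀ z, inner ℝ ((f x / ℓ x) • (InnerProductSpace.toDual ℝ _).symm ℓ) z =
      f x / ℓ x * ℓ z := fun z => by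
    rw [real_inner_smul_left, InnerProductSpace.toDual_symm_apply]
  refine ⟨(f x / ℓ x) • (InnerProductSpace.toDual ℝ _).symm ℓ,
    mem_subdifferential_iff.2 ⟨fun z => ?_, ?_⟩, ?_⟩
  · rw [hinner, div_mul_eq_mul_div, div_le_iff₀ hx0, mul_comm (f z)]
    exact hle z
  · rw [hinner, div_mul_cancel₀ _ hx0.ne']
  · rw [hinner]
    positivity

theorem subdifferential_nonempty (hfx : 0 < f x) : (subdifferential f x).Nonempty := by
  obtain ⟨s, hs, -⟩ := exists_mem_subdifferential_of_notMem_descentCone (y := x) hfx (by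
    rintro ⟨τ, hτ, h⟩
    have h1 : x + τ • x = (1 + τ) • x := by module
    rw [h1, map_smul_eq_mul, Real.norm_of_nonneg (by linarith)] at h
    nlinarith)
  exact ⟨s, hs⟩

/-- The closed descent cone is the polar of the subdifferential. -/
theorem closure_descentCone (hfx : 0 < f x) :
    closure (descentCone f x) = {y | ∀ s ∈ subdifferential f x, inner ℝ s y ≤ 0} := by
  refine subset_antisymm ?_ fun y hy => ?_
  · refine closure_minimal ?_ ?_
    · rintro y ⟨τ, hτ, h⟩ s hs
      have h1 := (hs (x + τ • y)).trans h
      rw [add_sub_cancel_left, inner_smul_right] at h1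
      exact nonpos_of_mul_nonpos_right (by linarith) hτ
    · simp only [Set.ofPred_forall]
      exact isClosed_iInter fun s => isClosed_iInter fun _ =>
        isClosed_le (by fun_prop) continuous_const
  -- Moving slightly in the direction `-x` makes all inner products with subgradients negative.
  have hlim : Filter.Tendsto (fun n : ℕ => y - (1 / ((n : ℝ) + 1)) • x) Filter.atTop (nhds y) := by
    simpa using (tendsto_const_nhds (x := y)).sub
      ((tendsto_one_div_add_atTop_nhds_zero_nat (𝕜 := ℝ)).smul_const x)
  refine mem_closure_of_tendsto hlim (Filter.Eventually.of_forall fun n => ?_)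
  by_contra hn
  obtain ⟨s, hs, h⟩ := exists_mem_subdifferential_of_notMem_descentCone hfx hn
  rw [inner_sub_right, inner_smul_right, (mem_subdifferential_iff.1 hs).2] at h
  have h1 := hy s hs
  have h2 : 0 < 1 / ((n : ℝ) + 1) * f x := by positivity
  linarith

/-- The cone generated by the subdifferential of a norm `f` at `x`, described by linear
inequalities (`subgradientCone_eq`); this description shows that it is closed. -/
def subgradientCone (f : Seminorm ℝ (EuclideanSpace ℝ (Fin d)))
    (x : EuclideanSpace ℝ (Fin d)) : Set (EuclideanSpace ℝ (Fin d)) :=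
  {v | ∀ z, f x * inner ℝ v z ≤ inner ℝ v x * f z}

theorem isClosed_subgradientCone : IsClosed (subgradientCone f x) := by
  simp only [subgradientCone, Set.ofPred_forall]
  exact isClosed_iInter fun z => isClosed_le (by fun_prop) (by fun_prop)

theorem convex_subgradientCone : Convex ℝ (subgradientCone f x) := by
  intro u hu v hv a b ha hb _ z
  simp only [inner_add_left, real_inner_smul_left]
  nlinarith [mul_le_mul_of_nonneg_left (hu z) ha, mul_le_mul_of_nonneg_left (hv z) hb]

theorem zero_mem_subgradientCone : (0 : EuclideanSpace ℝ (Fin d)) ∈ subgradientCone f x :=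
  fun z => by simp

theorem add_mem_subgradientCone {u v : EuclideanSpace ℝ (Fin d)} (hu : u ∈ subgradientCone f x)
    (hv : v ∈ subgradientCone f x) : u + v ∈ subgradientCone f x := fun z => by
  simp only [inner_add_left]
  nlinarith [hu z, hv z]

theorem smul_mem_subgradientCone {s : EuclideanSpace ℝ (Fin d)} (hs : s ∈ subdifferential f x)
    {τ : ℝ} (hτ : 0 ≤ τ) : τ • s ∈ subgradientCone f x := fun z => by
  obtain ⟨h1, h2⟩ := mem_subdifferential_iff.1 hs
  rw [real_inner_smul_left, real_inner_smul_left, h2]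
  have h3 := mul_le_mul_of_nonneg_left (h1 z) (mul_nonneg hτ (apply_nonneg f x))
  linarith

theorem inner_nonneg_of_mem_subgradientCone (hfx : 0 < f x) {v : EuclideanSpace ℝ (Fin d)}
    (hv : v ∈ subgradientCone f x) : 0 ≤ inner ℝ v x := by
  have h := hv (-x)
  rw [inner_neg_right, map_neg_eq_map] at h
  nlinarith

/-- The dilation factor of a point of the subgradient cone is its normalized inner product with
`x`. -/
theorem exists_eq_smul_of_mem_subgradientCone (hfx : 0 < f x) {v : EuclideanSpace ℝ (Fin d)}
    (hv : v ∈ subgradientCone f x) :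
    ∃ s ∈ subdifferential f x, v = (inner ℝ v x / f x) • s := by
  rcases (inner_nonneg_of_mem_subgradientCone hfx hv).eq_or_lt with h0 | hpos
  · obtain ⟨s, hs⟩ := subdifferential_nonempty hfx
    refine ⟨s, hs, ?_⟩
    have h := hv v
    rw [← h0, zero_mul] at h
    have h1 : inner ℝ v v ≤ 0 := nonpos_of_mul_nonpos_right h hfx
    rw [← h0, zero_div, zero_smul]
    exact inner_self_eq_zero.1 (le_antisymm h1 real_inner_self_nonneg)
  · refine ⟨(f x / inner ℝ v x) • v, mem_subdifferential_iff.2 ⟨fun z => ?_, ?_⟩, ?_⟩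
    · rw [real_inner_smul_left, div_mul_eq_mul_div, div_le_iff₀ hpos, mul_comm (f z)]
      exact hv z
    · rw [real_inner_smul_left, div_mul_cancel₀ _ hpos.ne']
    · rw [smul_smul, div_mul_div_cancel₀ hfx.ne', div_self hpos.ne', one_smul]

/-- Moreau's decomposition for the subgradient cone and the closed descent cone, which are polar
to each other. -/
theorem proj_closure_descentCone (hfx : 0 < f x) (u : EuclideanSpace ℝ (Fin d)) :
    proj (closure (descentCone f x)) u = u - proj (subgradientCone f x) u := by
  have hKne : (subgradientCone f x).Nonempty := ⟨0, zero_mem_subgradientCone⟩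
  obtain ⟨hpK, -⟩ := proj_spec hKne isClosed_subgradientCone convex_subgradientCone u
  have hVI := fun z => inner_sub_proj_le_zero hKne isClosed_subgradientCone
    convex_subgradientCone u (z := z)
  set p := proj (subgradientCone f x) u with hp
  obtain ⟨s₀, hs₀, hps⟩ := exists_eq_smul_of_mem_subgradientCone hfx hpK
  have hτ : 0 ≤ inner ℝ p x / f x :=
    div_nonneg (inner_nonneg_of_mem_subgradientCone hfx hpK) hfx.le
  have horth : inner ℝ (u - p) p = 0 := by
    have h1 := hVI 0 zero_mem_subgradientCone
    have h2 := hVI (p + p) (add_mem_subgradientCone hpK hpK)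
    rw [zero_sub, inner_neg_right] at h1
    rw [add_sub_cancel_right] at h2
    linarith
  have hmem : u - p ∈ closure (descentCone f x) := by
    rw [closure_descentCone hfx]
    intro s hs
    have h1 := hVI (p + s) (add_mem_subgradientCone hpK (by
      simpa using smul_mem_subgradientCone hs zero_le_one))
    rwa [add_sub_cancel_left, real_inner_comm] at h1
  have hconv : Convex ℝ (closure (descentCone f x)) := by
    rw [closure_descentCone hfx]
    intro y hy z hz a b ha hb _ s hs
    rw [inner_add_right, inner_smul_right, inner_smul_right]
    nlinarith [mul_nonpos_of_nonneg_of_nonpos ha (hy s hs),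
      mul_nonpos_of_nonneg_of_nonpos hb (hz s hs)]
  -- It remains to check that `u - p` is a nearest point, since `proj` picks the unique one.
  refine (existsUnique_argmin ⟨_, hmem⟩ isClosed_closure hconv u).unique
    (proj_spec ⟨_, hmem⟩ isClosed_closure hconv u) ⟨hmem, fun z hz => ?_⟩
  have hpz : inner ℝ p z ≤ 0 := by
    rw [closure_descentCone hfx] at hz
    rw [hps, real_inner_smul_left]
    exact mul_nonpos_of_nonneg_of_nonpos hτ (hz s₀ hs₀)
  have h1 : u - z = p + (u - p - z) := by abel
  rw [sub_sub_cancel, h1, norm_add_sq_real, inner_sub_right, real_inner_comm (u - p) p, horth]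
  nlinarith [sq_nonneg ‖u - p - z‖]

end Subdifferential

/-! ### The error bound -/

theorem mainTheorem7 (d : ℕ) (f : Seminorm ℝ (EuclideanSpace ℝ (Fin d)))
    (hf : ∀ y, f y = 0 → y = 0) (x : EuclideanSpace ℝ (Fin d)) (hx : x ≠ 0) :
    -- all the quantities in the error bound are well defined and finite
    (subdifferential f x).Nonempty ∧
    Bornology.IsBounded (subdifferential f x) ∧
    Integrable (fun g => ‖proj (closure (descentCone f x)) g‖ ^ 2)
      (stdGaussian (EuclideanSpace ℝ (Fin d))) ∧
    (∀ τ : ℝ, 0 ≤ τ → Integrable (fun g => Metric.infDist g (τ • subdifferential f x) ^ 2)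
      (stdGaussian (EuclideanSpace ℝ (Fin d)))) ∧
    -- the error bound
    |statDim (descentCone f x) - sInf (expectedSqDist (subdifferential f x) '' Set.Ici 0)| ≤
      2 * sSup ((fun s => ‖s‖) '' subdifferential f x) / f (‖x‖⁻¹ • x) := by
  have hfx : 0 < f x := (apply_nonneg f x).lt_of_ne fun h => hx (hf x h.symm)
  have hx0 : 0 < ‖x‖ := norm_pos_iff.2 hx
  set S := subdifferential f x with hSdef
  have hne : S.Nonempty := subdifferential_nonempty hfx
  have hS : IsCompact S := isCompact_subdifferential
  have hconv : Convex ℝ S := convex_subdifferential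
  set R := sSup ((fun s => ‖s‖) '' S) with hRdef
  have hRS : ∀ s ∈ S, ‖s‖ ≤ R := fun s hs =>
    le_csSup (hS.image continuous_norm).bddAbove (Set.mem_image_of_mem _ hs)
  have hR0 : 0 ≤ R := hne.elim fun s hs => (norm_nonneg s).trans (hRS s hs)
  have hRS' : ∀ s ∈ S, ‖s‖ ≤ R.toNNReal := fun s hs => by
    rw [Real.coe_toNNReal _ hR0]
    exact hRS s hs
  have hKne : (subgradientCone f x).Nonempty := ⟨0, zero_mem_subgradientCone⟩
  have hpLip : LipschitzWith 1 (proj (subgradientCone f x)) :=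
    lipschitzWith_proj hKne isClosed_subgradientCone convex_subgradientCone
  have hstat : Integrable (fun u => ‖u - proj (subgradientCone f x) u‖ ^ 2)
      (stdGaussian (EuclideanSpace ℝ (Fin d))) :=
    (lipschitzWith_sub_proj hKne isClosed_subgradientCone
      convex_subgradientCone).integrable_sq_norm_stdGaussian
  have hstatDim : statDim (descentCone f x) =
      ∫ u, ‖u - proj (subgradientCone f x) u‖ ^ 2
        ∂stdGaussian (EuclideanSpace ℝ (Fin d)) := by
    rw [statDim]
    simp_rw [proj_closure_descentCone hfx]
  refine ⟨hne, isBounded_subdifferential, ?_, fun τ hτ => ?_, ?_⟩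
  · simp_rw [proj_closure_descentCone hfx]
    exact hstat
  · simp_rw [infDist_smul_eq_norm_projResidual hS hne hconv]
    exact integrable_sq_projResidual hS hne hconv τ
  have hupper : ∀ τ, 0 ≤ τ → statDim (descentCone f x) ≤ expectedSqDist S τ := fun τ hτ => by
    rw [hstatDim, expectedSqDist_eq hS hne hconv]
    refine integral_mono hstat (integrable_sq_projResidual hS hne hconv τ) fun u => ?_
    obtain ⟨s, hs, hp, -⟩ := exists_proj_smul_eq hS hne hconv hτ u
    have h := (proj_spec hKne isClosed_subgradientCone convex_subgradientCone u).2 _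
      (smul_mem_subgradientCone hs hτ)
    rwa [← hp] at h
  have hSnorm : ∀ s ∈ S, f x / ‖x‖ ≤ ‖s‖ := fun s hs => by
    rw [div_le_iff₀ hx0, ← (mem_subdifferential_iff.1 hs).2]
    exact real_inner_le_norm s x
  obtain ⟨τ, hτ, hmin⟩ :=
    exists_forall_expectedSqDist_le hS hne hconv hRS' (div_pos hfx hx0) hSnorm
  -- The random dilation factor at which the distance to `τ • S` is minimal.
  set T : EuclideanSpace ℝ (Fin d) → ℝ :=
    fun u => inner ℝ (proj (subgradientCone f x) u) x / f x with hT
  have hT0 : ∀ u, 0 ≤ T u := fun u => div_nonneg (inner_nonneg_of_mem_subgradientCone hfx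
    (proj_spec hKne isClosed_subgradientCone convex_subgradientCone u).1) hfx.le
  have hTLip : LipschitzWith (‖x‖ / f x).toNNReal T := by
    refine LipschitzWith.of_le_add_mul _ fun u v => ?_
    rw [Real.coe_toNNReal _ (by positivity)]
    have h1 := real_inner_le_norm
      (proj (subgradientCone f x) u - proj (subgradientCone f x) v) x
    have h2 := hpLip.dist_le_mul u v
    rw [dist_eq_norm, NNReal.coe_one, one_mul] at h2
    have h3 := h1.trans (mul_le_mul_of_nonneg_right h2 hx0.le)
    rw [inner_sub_left] at h3
    have h4 := div_le_div_of_nonneg_right h3 hfx.le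
    rw [sub_div] at h4
    have h5 : dist u v * ‖x‖ / f x = ‖x‖ / f x * dist u v := by ring
    linarith
  have hHLip := lipschitzWith_supportFunction_projResidual hS hne hconv hRS' τ
  have hcov := (abs_le.1 (hTLip.abs_integral_mul_sub_le hHLip)).2
  rw [Real.coe_toNNReal _ hR0, Real.coe_toNNReal _ (by positivity)] at hcov
  have hopt := mul_meanSupport_nonpos hS hne hconv hRS' hτ hmin
    (integral_nonneg hT0 : 0 ≤ ∫ u, T u ∂stdGaussian (EuclideanSpace ℝ (Fin d)))
  have hHi := hHLip.integrable_stdGaussian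
  have hTH : Integrable (fun u => T u * supportFunction S (projResidual S τ u))
      (stdGaussian (EuclideanSpace ℝ (Fin d))) :=
    hTLip.memLp_two_stdGaussian.integrable_mul hHLip.memLp_two_stdGaussian
  have hFi := integrable_sq_projResidual hS hne hconv τ
  have hlower : expectedSqDist S τ - 2 * ∫ u, T u * supportFunction S (projResidual S τ u)
        ∂stdGaussian (EuclideanSpace ℝ (Fin d)) + 2 * τ * meanSupport S τ ≤
      statDim (descentCone f x) := by
    have h1 := integral_mono ((hFi.sub (hTH.const_mul 2)).add (hHi.const_mul (2 * τ))) hstat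
      fun u => by
        obtain ⟨s, hs, hps⟩ := exists_eq_smul_of_mem_subgradientCone hfx
          (proj_spec hKne isClosed_subgradientCone convex_subgradientCone u).1
        have h2 := sq_norm_projResidual_sub_le hS hne hconv hτ (hT0 u) u hs
        rw [← hps] at h2
        refine le_trans (le_of_eq ?_) h2
        simp only [Pi.add_apply, Pi.sub_apply]
        ring
    rwa [integral_add' (hFi.sub (hTH.const_mul 2)) (hHi.const_mul _),
      integral_sub' hFi (hTH.const_mul 2), integral_const_mul, integral_const_mul,
      ← expectedSqDist_eq hS hne hconv, ← hstatDim] at h1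
  have hinf1 : statDim (descentCone f x) ≤ sInf (expectedSqDist S '' Set.Ici 0) :=
    le_csInf (Set.nonempty_Ici.image _) (Set.forall_mem_image.2 hupper)
  have hinf2 : sInf (expectedSqDist S '' Set.Ici 0) ≤ expectedSqDist S τ :=
    csInf_le ⟨_, Set.forall_mem_image.2 hupper⟩ (Set.mem_image_of_mem _ hτ)
  have hbound : 2 * R / f (‖x‖⁻¹ • x) = 2 * (‖x‖ / f x * R) := by
    rw [map_smul_eq_mul, norm_inv, norm_norm]
    field_simp
  rw [hbound, abs_sub_comm, abs_of_nonneg (sub_nonneg.2 hinf1)]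
  change (∫ u, T u ∂_ - τ) * (∫ u, supportFunction S (projResidual S τ u) ∂_) ≤ 0 at hopt
  change expectedSqDist S τ - 2 * _ + 2 * τ * (∫ u, supportFunction S (projResidual S τ u) ∂_) ≤ _
    at hlower
  linarith
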